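/- Let $K$ be a nonzero commutative ring with unit, $\lambda\in K$, and $X$ a well-ordered set. Algebras are associative $K$-algebras, not necessarily unital. A $\lambda$-differential algebra is an algebra $R$ with a $K$-linear map $D:R\to R$ such that $D(ab)=D(a)b+aD(b)+\lambda D(a)D(b)$ for all $a,b\in R$. Let $\mathfrak S(X)$ be the semigroup of all (nonempty) words on $X$ in one unary operator $D$, i.e. the free semigroup on $X\sqcup D(\mathfrak S(X))$, and let $K\langle X;D\rangle$ be the algebra with $K$-basis $\mathfrak S(X)$, with $D$ extended linearly. Let $\mathfrak S^\star(X)$ be the set of words on $X\cup\{\star\}$ in which $\star$ occurs exactly once, and for $u\in\mathfrak S^\star(X)$ let $u|_s$ be the result of replacing $\star$ by $s$ in $u$. Order $\mathfrak S(X)$ by comparing, for $u=u_1\cdots u_n$ with $u_i\in X\cup D(\mathfrak S(X))$, the sequences $(\deg_X(u),u_1,\dots,u_n)$ lexicographically, where $\deg_X(u)$ is the number of occurrences of letters of $X$ in $u$; letters of $X$ are compared as in $X$, every $x\in X$ is smaller than every $D(u)$, and $D(u)<D(v)$ iff $u<v$. Let $\bar f$ be the leading word of $f\in K\langle X;D\rangle$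 for this order. Put $$S=\{D(xy)-D(x)y-xD(y)-\lambda D(x)D(y)\mid x,y\in\mathfrak S(X)\},$$ $$Irr(S)=\{w\in\mathfrak S(X)\mid w\neq u|_{\bar s}\text{ for all }u\in\mathfrak S^\star(X),\ s\in S\},$$ and $K\langle X;D|S\rangle=K\langle X;D\rangle/Id(S)$, where $Id(S)$ is the two-sided ideal, closed under $K$ and $D$, generated by $S$. Let $D^\omega(X)=\{D^i(x)\mid i\ge 0,\ x\in X\}$, and let $S(D^\omega(X))$ be the free semigroup on $D^\omega(X)$. Then: 1. The canonical homomorphism $S(D^\omega(X))\to\mathfrak S(X)$ is injective and its image is $Irr(S)$; that is, $Irr(S)=S(D^\omega(X))$. 2. The classes of the words in $Irr(S)=S(D^\omega(X))$ form a $K$-basis of $K\langle X;D|S\rangle$. 3. $K\langle X;D|S\rangle$, with the operator induced by $D$ and the map sending $x\in X$ to its class, is a free $\lambda$-differential algebra on the set $X$: it is a $\lambda$-differential algebra, and every map from $X$ to a $\lambda$-differential algebra $R$ extends uniquely to a homomorphism of $\lambda$-differential algebras $K\langle X;D|S\rangle\to R$. -/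

import Mathlib

universe u v w

/-! ### Words in one unary operator -/

/-- Prime words on `X` with one unary operator `D`: the letters `x ∈ X` and the words `D(u)`,
where `u` is a nonempty word (an element of the free semigroup on the prime words). -/
inductive DPrime (X : Type u) : Type u
  | var : X → DPrime X
  | op : FreeSemigroup (DPrime X) → DPrime X

/-- `𝔖(X)`: the semigroup of all words on `X` with one unary operator `D`. It is the free
semigroup on `X ∪ D(𝔖(X))`. -/
abbrev DWord (X : Type u) : Type u := FreeSemigroup (DPrime X)

namespace DWord

variable {X : Type u}

/-- The letter `x ∈ X` as a word. -/
def var (x : X) : DWord X := FreeSemigroup.of (DPrime.var x)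

/-- The operator `D : 𝔖(X) → 𝔖(X)`. -/
def op (u : DWord X) : DWord X := FreeSemigroup.of (DPrime.op u)

end DWord

section Eval

variable {X : Type u} {M : Type v} [Semigroup M] (d : M → M) (f : X → M)

mutual
/-- The value of a prime word in a semigroup `M` with a unary operation `d`, when the letters
are given the values `f`. -/
def DPrime.eval : DPrime X → M
  | DPrime.var x => f x
  | DPrime.op ⟨p, ps⟩ => d (DPrime.evalTail (DPrime.eval p) ps)
/-- The product of `a` with the values of the prime words of a list. -/
def DPrime.evalTail (a : M) : List (DPrime X) → M
  | [] => a
  | p :: ps => DPrime.evalTail (a * DPrime.eval p) ps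
end

/-- The homomorphism from `𝔖(X)` to a semigroup `M` with a unary operation `d` which extends
`f : X → M`; see `DWord.eval_var` and `DWord.eval_op`. -/
def DWord.eval : DWord X →ₙ* M := FreeSemigroup.lift (DPrime.eval d f)

theorem DPrime.evalTail_eq (a : M) (ps : List (DPrime X)) :
    DPrime.evalTail d f a ps = ps.foldl (fun b p => b * DPrime.eval d f p) a := by
  induction ps generalizing a with
  | nil => rw [DPrime.evalTail]; rfl
  | cons p ps ih => rw [DPrime.evalTail, ih]; rfl

theorem DWord.eval_var (x : X) : DWord.eval d f (DWord.var x) = f x := by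
  simp [DWord.eval, DWord.var, DPrime.eval]

theorem DWord.eval_op (u : DWord X) :
    DWord.eval d f (DWord.op u) = d (DWord.eval d f u) := by
  obtain ⟨p, ps⟩ := u
  simp [DWord.eval, DWord.op, DPrime.eval, DPrime.evalTail_eq, FreeSemigroup.lift_mk_eq_foldl]

end Eval

namespace DWord

variable {X : Type u}

/-- The sum of `f x` over all occurrences of letters `x` in the word `u`. -/
def weight (f : X → ℕ) (u : DWord X) : ℕ :=
  Multiplicative.toAdd (eval id (fun x => Multiplicative.ofAdd (f x)) u)

/-- `deg_X(u)`: the number of occurrences of letters from `X` in `u`. -/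
def degX (u : DWord X) : ℕ := weight (fun _ => 1) u

/-- The prime factors `u₁, …, uₙ` of `u = u₁ ⋯ uₙ`. -/
def factors (u : DWord X) : List (DPrime X) := u.head :: u.tail

/-- `𝔖^⋆(X)`: the words on `X ∪ {⋆}` in which `⋆` occurs exactly once; `⋆` is `none`. -/
def StarWord (X : Type u) : Type u :=
  {u : DWord (Option X) // weight (fun o => if o.isNone then 1 else 0) u = 1}

/-- `u|_s`: the word obtained from the `⋆`-word `u` by replacing `⋆` by the word `s`. -/
def StarWord.subst (u : StarWord X) (s : DWord X) : DWord X :=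
  eval op (fun o => o.elim s var) u.1

end DWord

/-! ### The monomial ordering -/

mutual
/-- The strict order on prime words: letters are ordered as in `X`, every letter is smaller
than every `D(u)`, and `D(u) < D(v)` iff `u < v`. -/
inductive DPrime.Lt {X : Type u} [LinearOrder X] : DPrime X → DPrime X → Prop
  | var_var {x y : X} : x < y → DPrime.Lt (DPrime.var x) (DPrime.var y)
  | var_op (x : X) (u : DWord X) : DPrime.Lt (DPrime.var x) (DPrime.op u)
  | op_op {u v : DWord X} : DWord.Lt u v → DPrime.Lt (DPrime.op u) (DPrime.op v)
/-- The strict order on words: `u₁ ⋯ uₙ < v₁ ⋯ vₘ` iff `(deg_X(u), u₁, …, uₙ)` is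
lexicographically smaller than `(deg_X(v), v₁, …, vₘ)`. -/
inductive DWord.Lt {X : Type u} [LinearOrder X] : DWord X → DWord X → Prop
  | of_degX {u v : DWord X} : u.degX < v.degX → DWord.Lt u v
  | of_lex {u v : DWord X} : u.degX = v.degX →
      List.Lex DPrime.Lt u.factors v.factors → DWord.Lt u v
end

/-! ### The free operated algebra `K⟨X; D⟩` -/

/-- `K⟨X; D⟩`: the (non-unital) associative `K`-algebra with basis `𝔖(X)`. -/
abbrev DPoly (K : Type v) [CommRing K] (X : Type u) : Type (max u v) :=
  MonoidAlgebra K (DWord X)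

namespace DPoly

variable (K : Type v) [CommRing K] {X : Type u}

/-- The word `u` as an element of `K⟨X; D⟩`. -/
noncomputable def word (u : DWord X) : DPoly K X := MonoidAlgebra.single u 1

/-- The operator `D` on `K⟨X; D⟩`, the `K`-linear extension of `D : 𝔖(X) → 𝔖(X)`. -/
noncomputable def opD : DPoly K X →ₗ[K] DPoly K X :=
  MonoidAlgebra.mapDomainLinearMap K K DWord.op

variable {K}

/-- `w` is the leading word of `f` with respect to the ordering `<`. -/
def IsLeadingWord [LinearOrder X] (f : DPoly K X) (w : DWord X) : Prop :=
  w ∈ f.coeff.support ∧ ∀ v ∈ f.coeff.support, v ≠ w → DWord.Lt v w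

/-- `Irr(S)`: the words which are not of the form `u|_s̄` for any `u ∈ 𝔖^⋆(X)` and `s ∈ S`,
where `s̄` is the leading word of `s`. -/
def Irr [LinearOrder X] (S : Set (DPoly K X)) : Set (DWord X) :=
  {w | ∀ (u : DWord.StarWord X), ∀ s ∈ S, ∀ l : DWord X, IsLeadingWord s l → w ≠ u.subst l}

/-- The set of all `D(xy) - D(x)y - xD(y) - λD(x)D(y)` with `x, y ∈ 𝔖(X)`. -/
def diffRelations (lam : K) (X : Type u) : Set (DPoly K X) :=
  {s | ∃ x y : DWord X,
    s = opD K (word K x * word K y) - opD K (word K x) * word K y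
      - word K x * opD K (word K y) - lam • (opD K (word K x) * opD K (word K y))}

end DPoly

/-! ### Quotients by operator ideals

Algebras are associative and not necessarily unital. -/

section Quotient

variable {K : Type v} [CommRing K] {A : Type u} [NonUnitalRing A] [Module K A]

/-- `I` is an ideal of the `K`-algebra `A` with operator `d`: a two-sided ideal (closed under
the scalars `K`) with `d(I) ⊆ I`. -/
structure IsOpIdeal (d : A →ₗ[K] A) (I : Submodule K A) : Prop where
  mul_left : ∀ a, ∀ x ∈ I, a * x ∈ I
  mul_right : ∀ a, ∀ x ∈ I, x * a ∈ I
  map_op : ∀ x ∈ I, d x ∈ I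

/-- `Id(S)`: the operator ideal generated by `S`. -/
def opIdeal (d : A →ₗ[K] A) (S : Set A) : Submodule K A :=
  sInf {I : Submodule K A | IsOpIdeal d I ∧ S ⊆ I}

theorem subset_opIdeal (d : A →ₗ[K] A) (S : Set A) : S ⊆ opIdeal d S := by
  intro s hs
  simp only [opIdeal, SetLike.mem_coe, Submodule.mem_sInf]
  exact fun I hI => hI.2 hs

theorem isOpIdeal_opIdeal (d : A →ₗ[K] A) (S : Set A) : IsOpIdeal d (opIdeal d S) := by
  simp only [opIdeal]
  constructor
  · intro a x hx
    rw [Submodule.mem_sInf] at hx ⊢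
    exact fun I hI => hI.1.mul_left a x (hx I hI)
  · intro a x hx
    rw [Submodule.mem_sInf] at hx ⊢
    exact fun I hI => hI.1.mul_right a x (hx I hI)
  · intro x hx
    rw [Submodule.mem_sInf] at hx ⊢
    exact fun I hI => hI.1.map_op x (hx I hI)

/-- The quotient of the algebra `A` with operator `d` by the operator ideal generated
by `S`. -/
def OpQuotient (d : A →ₗ[K] A) (S : Set A) : Type u := A ⧸ opIdeal d S

namespace OpQuotient

variable (d : A →ₗ[K] A) (S : Set A)

instance : AddCommGroup (OpQuotient d S) :=
  inferInstanceAs (AddCommGroup (A ⧸ opIdeal d S))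

instance : Module K (OpQuotient d S) :=
  inferInstanceAs (Module K (A ⧸ opIdeal d S))

/-- The canonical projection of `A` onto the quotient. -/
def mk : A →ₗ[K] OpQuotient d S := (opIdeal d S).mkQ

theorem mk_surjective : Function.Surjective (mk d S) := Submodule.mkQ_surjective _

/-- The multiplication of the quotient, induced by that of `A`. -/
instance : Mul (OpQuotient d S) where
  mul := Quotient.map₂ (· * ·) (by
    intro a a' ha b b' hb
    have ha' := (Submodule.quotientRel_def (opIdeal d S)).1 ha
    have hb' := (Submodule.quotientRel_def (opIdeal d S)).1 hb
    refine (Submodule.quotientRel_def (opIdeal d S)).2 ?_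
    have h : a * b - a' * b' = (a - a') * b + a' * (b - b') := by
      rw [sub_mul, mul_sub]; abel
    change a * b - a' * b' ∈ opIdeal d S
    rw [h]
    exact add_mem ((isOpIdeal_opIdeal d S).mul_right _ _ ha')
      ((isOpIdeal_opIdeal d S).mul_left _ _ hb'))

theorem mk_mul (a b : A) : mk d S (a * b) = mk d S a * mk d S b := rfl

instance : NonUnitalRing (OpQuotient d S) :=
  { (inferInstance : AddCommGroup (OpQuotient d S)),
    (inferInstance : Mul (OpQuotient d S)) with
    left_distrib := by
      intro x y z
      obtain ⟨a, rfl⟩ := mk_surjective d S x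
      obtain ⟨b, rfl⟩ := mk_surjective d S y
      obtain ⟨c, rfl⟩ := mk_surjective d S z
      simp only [← map_add, ← mk_mul, mul_add]
    right_distrib := by
      intro x y z
      obtain ⟨a, rfl⟩ := mk_surjective d S x
      obtain ⟨b, rfl⟩ := mk_surjective d S y
      obtain ⟨c, rfl⟩ := mk_surjective d S z
      simp only [← map_add, ← mk_mul, add_mul]
    zero_mul := by
      intro x
      obtain ⟨a, rfl⟩ := mk_surjective d S x
      rw [← map_zero (mk d S), ← mk_mul, zero_mul]
    mul_zero := by
      intro x
      obtain ⟨a, rfl⟩ := mk_surjective d S x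
      rw [← map_zero (mk d S), ← mk_mul, mul_zero]
    mul_assoc := by
      intro x y z
      obtain ⟨a, rfl⟩ := mk_surjective d S x
      obtain ⟨b, rfl⟩ := mk_surjective d S y
      obtain ⟨c, rfl⟩ := mk_surjective d S z
      simp only [← mk_mul, mul_assoc] }

instance [IsScalarTower K A A] : IsScalarTower K (OpQuotient d S) (OpQuotient d S) where
  smul_assoc := by
    intro k x y
    obtain ⟨a, rfl⟩ := mk_surjective d S x
    obtain ⟨b, rfl⟩ := mk_surjective d S y
    simp only [smul_eq_mul, ← map_smul, ← mk_mul, smul_mul_assoc]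

instance [SMulCommClass K A A] : SMulCommClass K (OpQuotient d S) (OpQuotient d S) where
  smul_comm := by
    intro k x y
    obtain ⟨a, rfl⟩ := mk_surjective d S x
    obtain ⟨b, rfl⟩ := mk_surjective d S y
    simp only [smul_eq_mul, ← map_smul, ← mk_mul, mul_smul_comm]

/-- The operator of the quotient, induced by `d`. -/
def op : OpQuotient d S →ₗ[K] OpQuotient d S :=
  Submodule.mapQ (opIdeal d S) (opIdeal d S) d (isOpIdeal_opIdeal d S).map_op

theorem op_mk (a : A) : op d S (mk d S a) = mk d S (d a) := rfl

end OpQuotient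

end Quotient

/-! ### Differential algebras of weight `λ` -/

/-- `d` makes the associative `K`-algebra `R` a `λ`-differential algebra. -/
def IsLambdaDiff {K : Type v} [CommRing K] {R : Type u} [NonUnitalRing R] [Module K R]
    (lam : K) (d : R →ₗ[K] R) : Prop :=
  ∀ x y : R, d (x * y) = d x * y + x * d y + lam • (d x * d y)

/-- `(F, d)` with `ι : X → F` is a free `λ`-differential algebra on the set `X`: it is a
`λ`-differential algebra, and every map from `X` to a `λ`-differential algebra `R` (in the
universe `r`) extends uniquely along `ι` to a homomorphism of `λ`-differential algebras. -/
def IsFreeLambdaDiff.{r, a, b, c} {K : Type a} [CommRing K] {X : Type b} {F : Type c}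
    [NonUnitalRing F] [Module K F] [IsScalarTower K F F] [SMulCommClass K F F]
    (lam : K) (d : F →ₗ[K] F) (ι : X → F) : Prop :=
  IsLambdaDiff lam d ∧
    ∀ (R : Type r) [NonUnitalRing R] [Module K R] [IsScalarTower K R R] [SMulCommClass K R R]
      (e : R →ₗ[K] R), IsLambdaDiff lam e → ∀ f : X → R,
        ∃! φ : F →ₙₐ[K] R, (∀ a, φ (d a) = e (φ a)) ∧ ∀ x, φ (ι x) = f x

/-! ### The algebra `K⟨X; D | S⟩` and its basis -/

/-- `D^ω(X) = {D^i(x) | i ≥ 0, x ∈ X}`. -/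
def DOmega (X : Type u) : Set (DWord X) :=
  {u | ∃ (i : ℕ) (x : X), u = DWord.op^[i] (DWord.var x)}

/-- The canonical homomorphism from the free semigroup on the set `D^ω(X)` to `𝔖(X)`. -/
def DOmega.toWord (X : Type u) : FreeSemigroup (DOmega X) →ₙ* DWord X :=
  FreeSemigroup.lift Subtype.val

/-- `K⟨X; D | S⟩ = K⟨X; D⟩ / Id(S)` for the set `S` of all
`D(xy) - D(x)y - xD(y) - λD(x)D(y)`. -/
abbrev DiffAlg {K : Type v} [CommRing K] (lam : K) (X : Type u) : Type (max u v) :=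
  OpQuotient (DPoly.opD K) (DPoly.diffRelations lam X)

namespace DiffAlg

variable {K : Type v} [CommRing K] (lam : K) {X : Type u}

/-- The operator `D` of `K⟨X; D | S⟩`. -/
noncomputable def opD : DiffAlg lam X →ₗ[K] DiffAlg lam X :=
  OpQuotient.op (DPoly.opD K) (DPoly.diffRelations lam X)

/-- The class of a word in `K⟨X; D | S⟩`. -/
noncomputable def word (u : DWord X) : DiffAlg lam X :=
  OpQuotient.mk (DPoly.opD K) (DPoly.diffRelations lam X) (DPoly.word K u)

end DiffAlg

/-! ### Words -/

namespace DWord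

variable {X : Type u}

-- The four words of the relation for `x, y` have the same degree. `D(xy)` is a single prime factor,
-- while the other three begin with a letter or with some `D(v)` where `deg v < deg (xy)`. So
-- `D(xy)` is the leading word (`isLeadingWord_relation_iff`). A word is then irreducible iff it has
-- no subword `D(xy)`, i.e. `D` is applied only to prime words, and such words are exactly the
-- products of elements `D^i(x)` (`mem_range_toWord_iff_not_contains`).
--
-- The basis is obtained without Gröbner–Shirshov bases. Spanning: the span of the words on `D^ω(X)`
-- contains the letters and is closed under products and, by the Leibniz rule, under `D`
-- (`omegaSpan_eq_top`). Independence: the algebra with basis the words on `D^ω(X)` carries a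
-- `λ`-derivation with `D^i(x) ↦ D^{i+1}(x)` (`isLambdaDiff_der`), so the quotient maps to it, and
-- the class of each such word goes to the corresponding basis vector (`toOmegaAlg_word`).
--
-- Freeness is formal: a map on letters extends to words, then linearly, and kills the relations; it
-- is unique because words span.

theorem induction {P : DWord X → Prop} (hvar : ∀ x, P (var x)) (hop : ∀ u, P u → P (op u))
    (hmul : ∀ u v, P u → P v → P (u * v)) (u : DWord X) : P u := by
  -- `DPrime` is nested through `FreeSemigroup` and `List`, so the recursor has three motives. The
  -- one for tails quantifies over the first factor, which turns a tail into a word.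
  have key : ∀ p : DPrime X, P (FreeSemigroup.of p) := fun p =>
    DPrime.rec (motive_1 := fun p => P (FreeSemigroup.of p)) (motive_2 := fun u => P u)
      (motive_3 := fun l => ∀ a, P (FreeSemigroup.of a) → P ⟨a, l⟩)
      hvar (fun u hu => hop u hu) (fun a l ha hl => hl a ha) (fun a ha => ha)
      (fun b l hb hl a ha => hmul (FreeSemigroup.of a) ⟨b, l⟩ ha (hl b hb)) p
  induction u using FreeSemigroup.recOnMul with
  | ih1 p => exact key p
  | ih2 p v hp hv => exact hmul _ _ hp hv

theorem op_injective : Function.Injective (op : DWord X → DWord X) := by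
  intro u v h
  exact DPrime.op.inj (FreeSemigroup.mk.inj h).1

theorem var_ne_op (x : X) (u : DWord X) : var x ≠ op u := by
  intro h
  cases (FreeSemigroup.mk.inj h).1

theorem mul_tail_ne_nil (u v : DWord X) : (u * v).tail ≠ [] := by simp

/-- A word is either prime or a product. -/
theorem eq_of_or_eq_mul (u : DWord X) :
    u = FreeSemigroup.of u.head ∨ ∃ v, u = FreeSemigroup.of u.head * v := by
  obtain ⟨p, _ | ⟨q, l⟩⟩ := u
  · exact Or.inl rfl
  · exact Or.inr ⟨⟨q, l⟩, rfl⟩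

@[simp] theorem factors_mul (u v : DWord X) : (u * v).factors = u.factors ++ v.factors := by
  simp [factors]

section weight

variable (f : X → ℕ)

@[simp] theorem weight_var (x : X) : weight f (var x) = f x := by
  simp [weight, eval_var]

@[simp] theorem weight_op (u : DWord X) : weight f (op u) = weight f u := by
  simp [weight, eval_op]

@[simp] theorem weight_mul (u v : DWord X) : weight f (u * v) = weight f u + weight f v := by
  simp [weight]

end weight

@[simp] theorem degX_op (u : DWord X) : (op u).degX = u.degX := weight_op _ u

@[simp] theorem degX_mul (u v : DWord X) : (u * v).degX = u.degX + v.degX := weight_mul _ u v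

theorem degX_pos (u : DWord X) : 0 < u.degX := by
  induction u using DWord.induction with
  | hvar x => simp [degX]
  | hop u hu => simpa using hu
  | hmul u v hu hv => simp; omega

theorem degX_of_head_le (u : DWord X) : degX (FreeSemigroup.of u.head) ≤ u.degX := by
  rcases eq_of_or_eq_mul u with h | ⟨v, h⟩
  · exact (congrArg degX h).ge
  · rw [h]; simp

/-! ### Substitution into star words -/

/-- The word `u` as a word on `X ∪ {⋆}`. -/
def toStar : DWord X →ₙ* DWord (Option X) := eval op (fun x => var (some x))

/-- The number of occurrences of `⋆`. -/
def starCount (u : DWord (Option X)) : ℕ := weight (fun o => if o.isNone then 1 else 0) u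

/-- Replace every `⋆` by `s`. -/
def substAll (s : DWord X) : DWord (Option X) →ₙ* DWord X := eval op (fun o => o.elim s var)

@[simp] theorem starCount_none : starCount (var (none : Option X)) = 1 := weight_var ..

@[simp] theorem starCount_some (x : X) : starCount (var (some x)) = 0 := weight_var ..

@[simp] theorem starCount_op (u : DWord (Option X)) : starCount (op u) = starCount u :=
  weight_op ..

@[simp] theorem starCount_mul (u v : DWord (Option X)) :
    starCount (u * v) = starCount u + starCount v := weight_mul ..

@[simp] theorem substAll_none (s : DWord X) : substAll s (var none) = s := eval_var ..

@[simp] theorem substAll_some (s : DWord X) (x : X) : substAll s (var (some x)) = var x :=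
  eval_var ..

@[simp] theorem substAll_op (s : DWord X) (u : DWord (Option X)) :
    substAll s (op u) = op (substAll s u) := eval_op ..

@[simp] theorem toStar_var (x : X) : toStar (var x) = var (some x) := eval_var ..

@[simp] theorem toStar_op (u : DWord X) : toStar (op u) = op (toStar u) := eval_op ..

theorem starCount_toStar (u : DWord X) : starCount (toStar u) = 0 := by
  induction u using DWord.induction with
  | hvar x => simp
  | hop u hu => simpa using hu
  | hmul u v hu hv => simp [hu, hv]

theorem substAll_toStar (s u : DWord X) : substAll s (toStar u) = u := by
  induction u using DWord.induction with
  | hvar x => simp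
  | hop u hu => simpa using congrArg op hu
  | hmul u v hu hv => simp [hu, hv]

/-- `Contains s w`: the word `w` has the form `u|_s` for some star word `u`. -/
def Contains (s w : DWord X) : Prop := ∃ u, starCount u = 1 ∧ w = substAll s u

theorem contains_iff (s w : DWord X) : Contains s w ↔ ∃ u : StarWord X, w = u.subst s :=
  ⟨fun ⟨u, hu, h⟩ => ⟨⟨u, hu⟩, h⟩, fun ⟨u, h⟩ => ⟨u.1, u.2, h⟩⟩

theorem Contains.refl (s : DWord X) : Contains s s := ⟨var none, by simp, by simp⟩

theorem Contains.op {s w : DWord X} : Contains s w → Contains s (op w) := by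
  rintro ⟨u, hu, rfl⟩
  exact ⟨DWord.op u, by simpa using hu, by simp⟩

theorem Contains.mul_left {s w : DWord X} (v : DWord X) : Contains s w → Contains s (v * w) := by
  rintro ⟨u, hu, rfl⟩
  exact ⟨toStar v * u, by simp [hu, starCount_toStar], by simp [substAll_toStar]⟩

theorem Contains.mul_right {s w : DWord X} (v : DWord X) :
    Contains s w → Contains s (w * v) := by
  rintro ⟨u, hu, rfl⟩
  exact ⟨u * toStar v, by simp [hu, starCount_toStar], by simp [substAll_toStar]⟩

end DWord

/-! ### The words in `D^ω(X)` -/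

namespace DOmega

open DWord

variable {X : Type u}

theorem var_mem (x : X) : var x ∈ DOmega X := ⟨0, x, rfl⟩

theorem op_mem_iff (u : DWord X) : op u ∈ DOmega X ↔ u ∈ DOmega X := by
  constructor
  · rintro ⟨_ | i, x, h⟩
    · exact (var_ne_op x u h.symm).elim
    · rw [Function.iterate_succ_apply'] at h
      exact ⟨i, x, op_injective h⟩
  · rintro ⟨i, x, rfl⟩
    exact ⟨i + 1, x, (Function.iterate_succ_apply' ..).symm⟩

theorem eq_of_head {u : DWord X} (hu : u ∈ DOmega X) : u = FreeSemigroup.of u.head := by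
  obtain ⟨_ | i, x, rfl⟩ := hu
  · rfl
  · rw [Function.iterate_succ_apply']; rfl

theorem mul_notMem (u v : DWord X) : u * v ∉ DOmega X := fun h =>
  mul_tail_ne_nil u v (by rw [eq_of_head h]; rfl)

/-- The letter `x` as an element of `D^ω(X)`. -/
def ofVar (x : X) : DOmega X := ⟨var x, var_mem x⟩

/-- The map `D^i(x) ↦ D^{i+1}(x)`. -/
def next (a : DOmega X) : DOmega X := ⟨op a.1, (op_mem_iff a.1).2 a.2⟩

theorem induction {P : DOmega X → Prop} (hvar : ∀ x, P (ofVar x))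
    (hnext : ∀ a, P a → P (next a)) (a : DOmega X) : P a := by
  obtain ⟨_, i, x, rfl⟩ := a
  induction i with
  | zero => exact hvar x
  | succ i ih =>
    have h := hnext _ ih
    simp only [next, ← Function.iterate_succ_apply' op] at h
    exact h

@[simp] theorem toWord_of (a : DOmega X) : toWord X (FreeSemigroup.of a) = a.1 := rfl

/-- A criterion factor by factor, from which the behaviour under products and under `D` can be read
off. -/
theorem mem_range_toWord_iff (u : DWord X) :
    u ∈ Set.range (toWord X) ↔ ∀ p ∈ u.factors, FreeSemigroup.of p ∈ DOmega X := by
  constructor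
  · rintro ⟨w, rfl⟩
    induction w using FreeSemigroup.recOnMul with
    | ih1 a =>
      intro p hp
      rw [toWord_of, eq_of_head a.2] at hp
      obtain rfl : p = a.1.head := by simpa [factors] using hp
      rw [← eq_of_head a.2]; exact a.2
    | ih2 a w ha hw =>
      intro p hp
      rw [map_mul, factors_mul, List.mem_append] at hp
      exact hp.elim (ha p) (hw p)
  · induction u using FreeSemigroup.recOnMul with
    | ih1 p => exact fun h => ⟨FreeSemigroup.of ⟨_, h p (by simp [factors])⟩, rfl⟩
    | ih2 p v hp hv =>
      intro h
      simp only [factors_mul, List.mem_append] at h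
      obtain ⟨a, ha⟩ := hp fun q hq => h q (Or.inl hq)
      obtain ⟨b, hb⟩ := hv fun q hq => h q (Or.inr hq)
      exact ⟨a * b, by rw [map_mul, ha, hb]⟩

theorem mul_mem_range_iff (u v : DWord X) :
    u * v ∈ Set.range (toWord X) ↔ u ∈ Set.range (toWord X) ∧ v ∈ Set.range (toWord X) := by
  simp only [mem_range_toWord_iff, factors_mul, List.mem_append, or_imp, forall_and]

theorem op_mem_range_iff (u : DWord X) : op u ∈ Set.range (toWord X) ↔ u ∈ DOmega X := by
  rw [mem_range_toWord_iff, ← op_mem_iff]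
  exact List.forall_mem_singleton

theorem subset_range (u : DWord X) (hu : u ∈ DOmega X) : u ∈ Set.range (toWord X) :=
  ⟨FreeSemigroup.of ⟨u, hu⟩, rfl⟩

/-- Elements of `D^ω(X)` are prime, so the factors of the image are the letters of the original
word, in order. -/
theorem toWord_injective : Function.Injective (toWord X) := by
  have hval : Function.Injective fun a : DOmega X => a.1.head := fun a b h =>
    Subtype.ext (by rw [eq_of_head a.2, eq_of_head b.2]; exact congrArg _ h)
  have key : ∀ w : FreeSemigroup (DOmega X), (toWord X w).factors
      = (w.head :: w.tail).map fun a => a.1.head := by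
    intro w
    induction w using FreeSemigroup.recOnMul with
    | ih1 a => rw [toWord_of, eq_of_head a.2]; rfl
    | ih2 a w ha hw => rw [map_mul, factors_mul, ha, hw]; simp
  intro w w' h
  have h' := hval.list_map ((key w).symm.trans ((congrArg factors h).trans (key w')))
  exact FreeSemigroup.ext (List.cons.inj h').1 (List.cons.inj h').2

/-- Words on `D^ω(X)` are closed under subwords: descend towards an occurrence of `⋆`. One
occurrence is enough, so the induction need not track the exact count. -/
theorem mem_range_of_subst {s : DWord X} (u : DWord (Option X)) (hu : 0 < starCount u)
    (h : substAll s u ∈ Set.range (toWord X)) : s ∈ Set.range (toWord X) := by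
  induction u using DWord.induction with
  | hvar o =>
    cases o with
    | none => simpa only [substAll_none] using h
    | some x => simp at hu
  | hop u ih =>
    rw [substAll_op, op_mem_range_iff] at h
    exact ih (by rwa [starCount_op] at hu) (subset_range _ h)
  | hmul u v ihu ihv =>
    rw [map_mul, mul_mem_range_iff] at h
    rw [starCount_mul] at hu
    rcases Nat.eq_zero_or_pos (starCount u) with h0 | h0
    · exact ihv (by omega) h.2
    · exact ihu h0 h.1

/-- The words on `D^ω(X)` are the words without a subword `D(xy)`. -/
theorem mem_range_toWord_iff_not_contains (w : DWord X) :
    w ∈ Set.range (toWord X) ↔ ∀ x y, ¬ Contains (op (x * y)) w := by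
  constructor
  · rintro hw x y ⟨u, hu, rfl⟩
    have h := mem_range_of_subst (s := op (x * y)) u (by omega) hw
    exact mul_notMem x y ((op_mem_range_iff _).1 h)
  · induction w using DWord.induction with
    | hvar x => exact fun _ => subset_range _ (var_mem x)
    | hop u ih =>
      intro h
      -- If `u` is prime, it is itself an element of `D^ω(X)`; if it is a product, `D(u)` is a
      -- forbidden subword.
      rcases eq_of_or_eq_mul u with hu | ⟨v, hu⟩
      · have h1 := ih fun x y hc => h x y hc.op
        rw [op_mem_range_iff, hu]
        exact (mem_range_toWord_iff u).1 h1 _ (by simp [factors])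
      · exact (h _ v (by rw [← hu]; exact Contains.refl _)).elim
    | hmul u v ihu ihv =>
      intro h
      exact (mul_mem_range_iff u v).2 ⟨ihu fun x y hc => h x y (hc.mul_right v),
        ihv fun x y hc => h x y (hc.mul_left u)⟩

end DOmega

/-! ### Leading words of the relations -/

namespace DWord

variable {X : Type u} {w t : DWord X}

/-- `t` has the degree of `D(w)`, and its first factor is a letter or `D(v)` with `v` of smaller
degree than `w`. -/
def IsBelowOp (w t : DWord X) : Prop :=
  t.degX = w.degX ∧
    ((∃ z, t.head = DPrime.var z) ∨ ∃ v : DWord X, t.head = DPrime.op v ∧ v.degX < w.degX)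

theorem IsBelowOp.lt [LinearOrder X] (h : IsBelowOp w t) : DWord.Lt t (op w) := by
  refine .of_lex (by rw [degX_op, h.1]) (.rel ?_)
  obtain ⟨-, ⟨z, hz⟩ | ⟨v, hv, hd⟩⟩ := h
  · rw [hz]; exact .var_op z w
  · rw [hv]; exact .op_op (.of_degX hd)

theorem IsBelowOp.ne (h : IsBelowOp w t) : t ≠ op w := by
  rintro rfl
  obtain ⟨-, ⟨z, hz⟩ | ⟨v, hv, hd⟩⟩ := h
  · cases hz
  · obtain rfl := DPrime.op.inj hv
    exact hd.false

/-- Takes the place of asymmetry of the order in showing that the leading word is unique. -/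
theorem IsBelowOp.not_lt [LinearOrder X] (h : IsBelowOp w t) : ¬ DWord.Lt (op w) t := by
  obtain ⟨hd, hh⟩ := h
  intro hlt
  cases hlt with
  | of_degX h' => rw [degX_op] at h'; omega
  | of_lex _ h' =>
    have : DPrime.Lt (DPrime.op w) t.head ∨ DPrime.op w = t.head := by
      rw [show (op w).factors = [DPrime.op w] from rfl, factors] at h'
      generalize t.head = p at h' ⊢
      cases h' with
      | rel h => exact Or.inl h
      | cons h => exact Or.inr rfl
    rcases hh with ⟨z, hz⟩ | ⟨v, hv, hlt⟩
    · rw [hz] at this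
      rcases this with h | h <;> cases h
    · rw [hv] at this
      rcases this with h | h
      · cases h with
        | op_op h =>
          cases h with
          | of_degX h => omega
          | of_lex h _ => omega
      · cases h; omega

/-- Degrees are positive, so `deg x < deg (xy)`. The free `z` covers both `D(x)y` and `D(x)D(y)`. -/
theorem isBelowOp_op_mul (x y z : DWord X) (hz : z.degX = y.degX) :
    IsBelowOp (x * y) (op x * z) :=
  ⟨by simp [hz], Or.inr ⟨x, rfl, by simpa using degX_pos y⟩⟩

/-- The first factor of `x` has degree at most `deg x`, which is less than `deg (xy)`. -/
theorem isBelowOp_mul_op (x y : DWord X) : IsBelowOp (x * y) (x * op y) := by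
  refine ⟨by simp, ?_⟩
  have h := degX_of_head_le x
  rw [FreeSemigroup.head_mul]
  cases hx : x.head with
  | var z => exact Or.inl ⟨z, rfl⟩
  | op v =>
    refine Or.inr ⟨v, rfl, ?_⟩
    rw [hx] at h
    have h' : degX v ≤ x.degX := (degX_op v).symm.trans_le h
    have := degX_pos y
    rw [degX_mul]; omega

end DWord


-- The relations and their irreducible words.

namespace DPoly

variable {K : Type v} [CommRing K] (lam : K) {X : Type u}

theorem word_mul (u v : DWord X) : word K (u * v) = word K u * word K v := by
  simp [word, MonoidAlgebra.single_mul_single]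

theorem opD_word (u : DWord X) : opD K (word K u) = word K (DWord.op u) :=
  MonoidAlgebra.mapDomainLinearMap_single ..

theorem linearMap_ext {M : Type w} {N : Type*} [AddCommMonoid N] [Module K N]
    {f g : MonoidAlgebra K M →ₗ[K] N}
    (h : ∀ m, f (MonoidAlgebra.single m 1) = g (MonoidAlgebra.single m 1)) : f = g :=
  MonoidAlgebra.lhom_ext' fun m => LinearMap.ext_ring (h m)

theorem span_single {M : Type w} : Submodule.span K
    (Set.range fun m : M => MonoidAlgebra.single m (1 : K)) = ⊤ := by
  rw [eq_top_iff]
  intro f _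
  rw [← f.sum_coeff_single]
  refine Submodule.sum_mem _ fun m _ => ?_
  have h : MonoidAlgebra.single m (f.coeff m) = f.coeff m • MonoidAlgebra.single m (1 : K) := by
    simp
  rw [h]
  exact Submodule.smul_mem _ _ (Submodule.subset_span ⟨m, rfl⟩)

/-- The relation `D(xy) - D(x)y - xD(y) - λD(x)D(y)`. -/
noncomputable def relation (x y : DWord X) : DPoly K X :=
  opD K (word K x * word K y) - opD K (word K x) * word K y
      - word K x * opD K (word K y) - lam • (opD K (word K x) * opD K (word K y))

theorem relation_mem (x y : DWord X) : relation lam x y ∈ diffRelations lam X := ⟨x, y, rfl⟩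

theorem relation_eq (x y : DWord X) : relation lam x y =
    word K (DWord.op (x * y)) - word K (DWord.op x * y) - word K (x * DWord.op y)
      - lam • word K (DWord.op x * DWord.op y) := by
  simp only [relation, ← word_mul, opD_word]

-- The other three words differ from `D(xy)`, which therefore has coefficient `1 ≠ 0`. Everything
-- else in the support is one of these three, hence below `D(xy)`; whether they cancel or vanish
-- does not matter.
open DWord in
theorem isLeadingWord_relation_iff [Nontrivial K] [LinearOrder X] (x y l : DWord X) :
    IsLeadingWord (relation lam x y) l ↔ l = op (x * y) := by
  classical
  have h1 := isBelowOp_op_mul x y y rfl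
  have h2 := isBelowOp_mul_op x y
  have h3 := isBelowOp_op_mul x y (op y) (degX_op y)
  have hc : ∀ v, (relation lam x y).coeff v = (if op (x * y) = v then 1 else 0)
      - (if op x * y = v then 1 else 0) - (if x * op y = v then 1 else 0)
      - lam * (if op x * op y = v then 1 else 0) := by
    intro v
    simp [relation_eq, word, Finsupp.single_apply]
  have hmem : op (x * y) ∈ (relation lam x y).coeff.support := by
    rw [Finsupp.mem_support_iff, hc]
    simp [h1.ne, h2.ne, h3.ne]
  have hbelow : ∀ v ∈ (relation lam x y).coeff.support, v ≠ op (x * y) → IsBelowOp (x * y) v := by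
    intro v hv hne
    rw [Finsupp.mem_support_iff, hc] at hv
    by_contra hnot
    have e1 : op x * y ≠ v := by rintro rfl; exact hnot h1
    have e2 : x * op y ≠ v := by rintro rfl; exact hnot h2
    have e3 : op x * op y ≠ v := by rintro rfl; exact hnot h3
    refine hv ?_
    rw [if_neg hne.symm, if_neg e1, if_neg e2, if_neg e3]
    simp
  constructor
  · intro hl
    by_contra hne
    exact (hbelow l hl.1 hne).not_lt (hl.2 _ hmem (Ne.symm hne))
  · rintro rfl
    exact ⟨hmem, fun v hv hne => (hbelow v hv hne).lt⟩

theorem irr_diffRelations [Nontrivial K] [LinearOrder X] :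
    Irr (diffRelations lam X) = Set.range (DOmega.toWord X) := by
  ext w
  rw [DOmega.mem_range_toWord_iff_not_contains]
  simp only [DWord.contains_iff, not_exists]
  constructor
  · intro h x y u
    exact h u _ (relation_mem lam x y) _ ((isLeadingWord_relation_iff lam x y _).2 rfl)
  · rintro h u _ ⟨x, y, rfl⟩ l hl
    rw [(isLeadingWord_relation_iff lam x y l).1 hl]
    exact h x y u

end DPoly

/-! ### Homomorphisms from quotients -/

namespace OpQuotient

variable {K : Type v} [CommRing K] {A : Type u} [NonUnitalRing A] [Module K A]
  (d : A →ₗ[K] A) (S : Set A) {R : Type w} [NonUnitalRing R] [Module K R]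

/-- The kernel of `φ` is an operator ideal containing `S`, and `Id(S)` is the least one. -/
theorem eq_zero_of_mem_opIdeal (e : R →ₗ[K] R) (φ : A →ₙₐ[K] R) (hφ : ∀ a, φ (d a) = e (φ a))
    (hS : ∀ s ∈ S, φ s = 0) {a : A} (ha : a ∈ opIdeal d S) : φ a = 0 := by
  have hle : opIdeal d S ≤ LinearMap.ker (φ : A →ₗ[K] R) := by
    refine sInf_le ⟨⟨?_, ?_, ?_⟩, fun s hs => hS s hs⟩
    · intro a x hx
      have hx' : φ x = 0 := hx
      change φ (a * x) = 0
      rw [map_mul, hx', mul_zero]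
    · intro a x hx
      have hx' : φ x = 0 := hx
      change φ (x * a) = 0
      rw [map_mul, hx', zero_mul]
    · intro x hx
      have hx' : φ x = 0 := hx
      change φ (d x) = 0
      rw [hφ, hx', map_zero]
  exact hle ha

/-- The homomorphism from the quotient induced by a homomorphism which vanishes on `Id(S)`. -/
def lift (φ : A →ₙₐ[K] R) (h : ∀ a ∈ opIdeal d S, φ a = 0) : OpQuotient d S →ₙₐ[K] R :=
  let f : OpQuotient d S →ₗ[K] R := (opIdeal d S).liftQ (φ : A →ₗ[K] R) h
  { toFun := f
    map_smul' := f.map_smul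
    map_zero' := f.map_zero
    map_add' := f.map_add
    map_mul' := by
      intro x y
      obtain ⟨a, rfl⟩ := mk_surjective d S x
      obtain ⟨b, rfl⟩ := mk_surjective d S y
      exact map_mul φ a b }

theorem lift_mk (φ : A →ₙₐ[K] R) (h : ∀ a ∈ opIdeal d S, φ a = 0) (a : A) :
    lift d S φ h (mk d S a) = φ a := rfl

end OpQuotient

/-- The Leibniz rule of weight `λ` holds if it holds on a spanning set. -/
theorem IsLambdaDiff.of_span {K : Type v} [CommRing K] {R : Type u} [NonUnitalRing R] [Module K R]
    [IsScalarTower K R R] [SMulCommClass K R R] {lam : K} {d : R →ₗ[K] R} {s : Set R}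
    (hs : Submodule.span K s = ⊤)
    (h : ∀ x ∈ s, ∀ y ∈ s, d (x * y) = d x * y + x * d y + lam • (d x * d y)) :
    IsLambdaDiff lam d := by
  intro x y
  have hx : x ∈ Submodule.span K s := hs ▸ Submodule.mem_top
  have hy : y ∈ Submodule.span K s := hs ▸ Submodule.mem_top
  induction hx, hy using Submodule.span_induction₂ with
  | mem_mem x y hx hy => exact h x hx y hy
  | zero_left y hy => simp
  | zero_right x hx => simp
  | add_left x y z hx hy hz h1 h2 =>
    simp only [add_mul, map_add, h1, h2, smul_add]; abel
  | add_right x y z hx hy hz h1 h2 =>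
    simp only [mul_add, map_add, h1, h2, smul_add]; abel
  | smul_left r x y hx hy h =>
    simp only [smul_mul_assoc, map_smul, h, smul_add, smul_comm lam r]
  | smul_right r x y hx hy h =>
    simp only [mul_smul_comm, map_smul, h, smul_add, smul_comm lam r]

/-! ### Freeness of the quotient -/

namespace DiffAlg

variable {K : Type v} [CommRing K] (lam : K) {X : Type u}

theorem word_mul (u v : DWord X) : word lam (u * v) = word lam u * word lam v := by
  rw [word, DPoly.word_mul, OpQuotient.mk_mul]; rfl

theorem opD_word (u : DWord X) : opD lam (word lam u) = word lam (DWord.op u) := by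
  rw [word, opD, OpQuotient.op_mk, DPoly.opD_word]; rfl

theorem span_word : Submodule.span K (Set.range (word lam : DWord X → DiffAlg lam X)) = ⊤ := by
  have h := congrArg (Submodule.map (OpQuotient.mk (DPoly.opD K) (DPoly.diffRelations lam X)))
    (DPoly.span_single (K := K) (M := DWord X))
  rw [Submodule.map_span, Submodule.map_top, ← Set.range_comp] at h
  exact h.trans (LinearMap.range_eq_top.2 (OpQuotient.mk_surjective _ _))

/-- Both sides are bilinear, and on words the Leibniz rule is precisely a relation in `S`. -/
theorem isLambdaDiff : IsLambdaDiff lam (opD lam : DiffAlg lam X →ₗ[K] DiffAlg lam X) := by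
  refine .of_span (span_word lam) ?_
  rintro _ ⟨x, rfl⟩ _ ⟨y, rfl⟩
  have h := (Submodule.Quotient.mk_eq_zero _).2
    (subset_opIdeal (DPoly.opD K) _ (DPoly.relation_mem lam x y))
  change OpQuotient.mk (DPoly.opD K) (DPoly.diffRelations lam X) (DPoly.relation lam x y) = 0 at h
  rw [DPoly.relation_eq, map_sub, map_sub, map_sub, map_smul] at h
  change word lam _ - word lam _ - word lam _ - lam • word lam _ = 0 at h
  simp only [opD_word, ← word_mul]
  rw [sub_sub, sub_sub, sub_eq_zero] at h
  rw [h, add_assoc]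

section lift

variable {R : Type w} [NonUnitalRing R] [Module K R] [IsScalarTower K R R] [SMulCommClass K R R]
  (e : R →ₗ[K] R) (f : X → R)

/-- The homomorphism `K⟨X; D⟩ → R` of algebras with operator which extends `f`. -/
noncomputable def _root_.DPoly.lift : DPoly K X →ₙₐ[K] R :=
  MonoidAlgebra.liftMagma K (DWord.eval e f)

theorem _root_.DPoly.lift_word (u : DWord X) :
    DPoly.lift e f (DPoly.word K u) = DWord.eval e f u := by
  simp [DPoly.lift, DPoly.word]

theorem _root_.DPoly.lift_opD (a : DPoly K X) :
    DPoly.lift e f (DPoly.opD K a) = e (DPoly.lift e f a) := by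
  have h : (DPoly.lift e f : DPoly K X →ₗ[K] R) ∘ₗ DPoly.opD K =
      e ∘ₗ (DPoly.lift e f : DPoly K X →ₗ[K] R) := by
    refine DPoly.linearMap_ext fun u => ?_
    change DPoly.lift e f (DPoly.opD K (DPoly.word K u)) = e (DPoly.lift e f (DPoly.word K u))
    rw [DPoly.opD_word, DPoly.lift_word, DPoly.lift_word, DWord.eval_op]
  exact LinearMap.congr_fun h a

variable {lam e}

/-- The homomorphism of `λ`-differential algebras `K⟨X; D | S⟩ → R` which extends `f`. -/
noncomputable def lift (he : IsLambdaDiff lam e) : DiffAlg lam X →ₙₐ[K] R :=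
  OpQuotient.lift _ _ (DPoly.lift e f) fun _ =>
    OpQuotient.eq_zero_of_mem_opIdeal _ _ e _ (DPoly.lift_opD e f) (by
      -- A relation is sent to the defect of the Leibniz rule in `R`.
      rintro _ ⟨x, y, rfl⟩
      simp only [map_sub, map_smul, map_mul, DPoly.lift_opD, he _ _]
      abel)

theorem lift_word (he : IsLambdaDiff lam e) (u : DWord X) :
    lift f he (word lam u) = DWord.eval e f u :=
  (OpQuotient.lift_mk _ _ _ _ _).trans (DPoly.lift_word e f u)

theorem lift_opD (he : IsLambdaDiff lam e) (a : DiffAlg lam X) :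
    lift f he (opD lam a) = e (lift f he a) := by
  obtain ⟨a, rfl⟩ := OpQuotient.mk_surjective _ _ a
  exact DPoly.lift_opD e f a

end lift

theorem isFreeLambdaDiff :
    IsFreeLambdaDiff.{w} lam (opD lam) (fun x : X => word lam (DWord.var x)) := by
  refine ⟨isLambdaDiff lam, fun R _ _ _ _ e he f => ⟨lift f he, ⟨lift_opD f he, fun x => ?_⟩, ?_⟩⟩
  · simp only [lift_word, DWord.eval_var]
  · rintro φ ⟨hφ, hx⟩
    have h : (φ : DiffAlg lam X →ₗ[K] R) = (lift f he : DiffAlg lam X →ₗ[K] R) := by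
      refine LinearMap.ext_on_range (span_word lam) fun u => ?_
      change φ (word lam u) = lift f he (word lam u)
      rw [lift_word]
      induction u using DWord.induction with
      | hvar x => rw [DWord.eval_var]; exact hx x
      | hop u hu => rw [← opD_word, hφ, hu, DWord.eval_op]
      | hmul u v hu hv => rw [word_mul, map_mul, map_mul, hu, hv]
    exact NonUnitalAlgHom.ext fun a => LinearMap.congr_fun h a

/-! ### The words on `D^ω(X)` span -/

/-- The span of the classes of the words on `D^ω(X)`. -/
noncomputable def omegaSpan : Submodule K (DiffAlg lam X) :=
  Submodule.span K (Set.range fun w => word lam (DOmega.toWord X w))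

theorem word_toWord_mem_omegaSpan (w : FreeSemigroup (DOmega X)) :
    word lam (DOmega.toWord X w) ∈ omegaSpan lam := Submodule.subset_span ⟨w, rfl⟩

theorem mul_mem_omegaSpan {a b : DiffAlg lam X} (ha : a ∈ omegaSpan lam)
    (hb : b ∈ omegaSpan lam) : a * b ∈ omegaSpan lam := by
  rw [omegaSpan] at ha hb
  induction ha, hb using Submodule.span_induction₂ with
  | mem_mem x y hx hy =>
    obtain ⟨v, rfl⟩ := hx
    obtain ⟨w, rfl⟩ := hy
    have h := word_toWord_mem_omegaSpan lam (v * w)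
    rwa [map_mul, word_mul] at h
  | zero_left y hy => rw [zero_mul]; exact zero_mem _
  | zero_right x hx => rw [mul_zero]; exact zero_mem _
  | add_left x y z hx hy hz h1 h2 => rw [add_mul]; exact add_mem h1 h2
  | add_right x y z hx hy hz h1 h2 => rw [mul_add]; exact add_mem h1 h2
  | smul_left r x y hx hy h => rw [smul_mul_assoc]; exact Submodule.smul_mem _ _ h
  | smul_right r x y hx hy h => rw [mul_smul_comm]; exact Submodule.smul_mem _ _ h

/-- Induction on the length of a word: `D` takes a letter `D^i(x)` to the letter `D^{i+1}(x)`, and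
the Leibniz rule reduces `D` of a product to `D` of its first letter and of the shorter remaining
word. -/
theorem opD_mem_omegaSpan {a : DiffAlg lam X} (ha : a ∈ omegaSpan lam) :
    opD lam a ∈ omegaSpan lam := by
  rw [omegaSpan] at ha
  induction ha using Submodule.span_induction with
  | mem x hx =>
    obtain ⟨w, rfl⟩ := hx
    have hof : ∀ a : DOmega X, opD lam (word lam (DOmega.toWord X (FreeSemigroup.of a))) ∈
        omegaSpan lam := by
      intro a
      rw [opD_word]
      exact word_toWord_mem_omegaSpan lam (FreeSemigroup.of (DOmega.next a))
    dsimp only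
    induction w using FreeSemigroup.recOnMul with
    | ih1 a => exact hof a
    | ih2 a w _ hw =>
      have h1 := word_toWord_mem_omegaSpan lam (FreeSemigroup.of a)
      have h2 := word_toWord_mem_omegaSpan lam w
      rw [map_mul, word_mul, isLambdaDiff lam]
      exact add_mem (add_mem (mul_mem_omegaSpan lam (hof a) h2) (mul_mem_omegaSpan lam h1 hw))
        (Submodule.smul_mem _ _ (mul_mem_omegaSpan lam (hof a) hw))
  | zero => rw [map_zero]; exact zero_mem _
  | add x y _ _ hx hy => rw [map_add]; exact add_mem hx hy
  | smul r x _ hx => rw [map_smul]; exact Submodule.smul_mem _ _ hx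

theorem omegaSpan_eq_top : omegaSpan lam = (⊤ : Submodule K (DiffAlg lam X)) := by
  rw [eq_top_iff, ← span_word, Submodule.span_le]
  rintro _ ⟨u, rfl⟩
  rw [SetLike.mem_coe]
  induction u using DWord.induction with
  | hvar x => exact word_toWord_mem_omegaSpan lam (FreeSemigroup.of (DOmega.ofVar x))
  | hop u hu => rw [← opD_word]; exact opD_mem_omegaSpan lam hu
  | hmul u v hu hv => rw [word_mul]; exact mul_mem_omegaSpan lam hu hv

end DiffAlg

/-! ### The free `λ`-differential algebra on words in `D^ω(X)` -/

/-- Pairs `(a, b)` of elements of `R` with the product for which `a ↦ (a, d a)` is multiplicative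
whenever `d` satisfies the Leibniz rule of weight `λ`. -/
structure LeibnizPair {K : Type v} (lam : K) (R : Type u) where
  /-- The value. -/
  val : R
  /-- The derivative. -/
  der : R

namespace LeibnizPair

variable {K : Type v} [CommRing K] (lam : K) {R : Type u} [NonUnitalRing R] [Module K R]

instance : Mul (LeibnizPair lam R) where
  mul a b := ⟨a.val * b.val, a.der * b.val + a.val * b.der + lam • (a.der * b.der)⟩

theorem val_mul (a b : LeibnizPair lam R) : (a * b).val = a.val * b.val := rfl

theorem der_mul (a b : LeibnizPair lam R) :
    (a * b).der = a.der * b.val + a.val * b.der + lam • (a.der * b.der) := rfl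

/-- Both bracketings have as derivative the sum over nonempty subsets `T` of the three factors,
where the factors in `T` are differentiated and the term is weighted by `λ^(|T|-1)`. -/
instance [IsScalarTower K R R] [SMulCommClass K R R] : Semigroup (LeibnizPair lam R) where
  mul_assoc a b c := by
    have h : ∀ x y : LeibnizPair lam R, x.val = y.val → x.der = y.der → x = y := by
      rintro ⟨_, _⟩ ⟨_, _⟩ rfl rfl; rfl
    refine h _ _ (mul_assoc ..) ?_
    simp only [der_mul, val_mul, add_mul, mul_add, smul_add, smul_mul_assoc, mul_smul_comm,
      mul_assoc]
    abel

end LeibnizPair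

/-- The (non-unital) algebra with basis the words on `D^ω(X)`. -/
abbrev OmegaAlg (K : Type v) [CommRing K] (X : Type u) : Type (max u v) :=
  MonoidAlgebra K (FreeSemigroup (DOmega X))

namespace OmegaAlg

variable {K : Type v} [CommRing K] (lam : K) {X : Type u}

/-- A word on `D^ω(X)` together with its derivative. -/
noncomputable def pair : FreeSemigroup (DOmega X) →ₙ* LeibnizPair lam (OmegaAlg K X) :=
  FreeSemigroup.lift fun a => ⟨MonoidAlgebra.single (FreeSemigroup.of a) 1,
    MonoidAlgebra.single (FreeSemigroup.of (DOmega.next a)) 1⟩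

theorem val_pair (w : FreeSemigroup (DOmega X)) :
    (pair lam w).val = MonoidAlgebra.single w (1 : K) := by
  induction w using FreeSemigroup.recOnMul with
  | ih1 a => rfl
  | ih2 a w ha hw =>
    rw [map_mul, LeibnizPair.val_mul, ha, hw, MonoidAlgebra.single_mul_single, one_mul]

/-- The derivation of weight `λ` with `D^i(x) ↦ D^{i+1}(x)`. -/
noncomputable def der : OmegaAlg K X →ₗ[K] OmegaAlg K X :=
  (Finsupp.linearCombination K fun w => (pair lam w).der) ∘ₗ
    (MonoidAlgebra.coeffLinearEquiv K).toLinearMap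

theorem der_single (w : FreeSemigroup (DOmega X)) :
    der lam (MonoidAlgebra.single w (1 : K)) = (pair lam w).der := by
  simp [der]

/-- On basis words the Leibniz rule is the second component of the multiplicativity of `pair`. -/
theorem isLambdaDiff_der : IsLambdaDiff lam (der lam : OmegaAlg K X →ₗ[K] OmegaAlg K X) := by
  refine .of_span DPoly.span_single ?_
  rintro _ ⟨v, rfl⟩ _ ⟨w, rfl⟩
  dsimp only
  rw [MonoidAlgebra.single_mul_single, one_mul, der_single, der_single, der_single, map_mul,
    LeibnizPair.der_mul, val_pair, val_pair]

end OmegaAlg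

-- Linear independence and the basis.

namespace DiffAlg

variable {K : Type v} [CommRing K] (lam : K) {X : Type u}

/-- The homomorphism from `K⟨X; D | S⟩` to the algebra with basis the words on `D^ω(X)`. -/
noncomputable def toOmegaAlg : DiffAlg lam X →ₙₐ[K] OmegaAlg K X :=
  lift (fun x => MonoidAlgebra.single (FreeSemigroup.of (DOmega.ofVar x)) 1)
    (OmegaAlg.isLambdaDiff_der lam)

/-- The separation result: distinct words on `D^ω(X)` acquire distinct basis vectors as images. On a
letter `D^i(x)` it follows by induction on `i`, since the map commutes with the operators; products
are multiplicative. -/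
theorem toOmegaAlg_word (w : FreeSemigroup (DOmega X)) :
    toOmegaAlg lam (word lam (DOmega.toWord X w)) = MonoidAlgebra.single w (1 : K) := by
  induction w using FreeSemigroup.recOnMul with
  | ih1 a =>
    induction a using DOmega.induction with
    | hvar x => exact (lift_word _ _ _).trans (DWord.eval_var ..)
    | hnext a ha =>
      rw [DOmega.toWord_of] at ha ⊢
      rw [DOmega.next, ← opD_word, toOmegaAlg, lift_opD]
      rw [toOmegaAlg] at ha
      rw [ha, OmegaAlg.der_single]
      rfl
  | ih2 a w ha hw =>
    rw [map_mul, word_mul, map_mul, ha, hw, MonoidAlgebra.single_mul_single, one_mul]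

theorem linearIndependent_word_toWord :
    LinearIndependent K fun w => word lam (DOmega.toWord X w) := by
  refine LinearIndependent.of_comp ((toOmegaAlg lam (X := X)) : DiffAlg lam X →ₗ[K] OmegaAlg K X) ?_
  -- Independence can be tested after applying a linear map; in coefficients the images are the
  -- standard basis vectors.
  refine LinearIndependent.of_comp
    (MonoidAlgebra.coeffLinearEquiv K : OmegaAlg K X ≃ₗ[K] _).toLinearMap ?_
  convert Finsupp.linearIndependent_single_one K (FreeSemigroup (DOmega X)) using 1
  funext w
  exact congrArg MonoidAlgebra.coeff (toOmegaAlg_word lam w)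

/-- The basis of `K⟨X; D | S⟩` consisting of the classes of the words on `D^ω(X)`. -/
noncomputable def omegaBasis : Module.Basis (FreeSemigroup (DOmega X)) K (DiffAlg lam X) :=
  .mk (linearIndependent_word_toWord lam) (omegaSpan_eq_top lam).ge

theorem omegaBasis_apply (w : FreeSemigroup (DOmega X)) :
    omegaBasis lam w = word lam (DOmega.toWord X w) := Module.Basis.mk_apply ..

end DiffAlg

theorem mainTheorem5 {K : Type v} [CommRing K] [Nontrivial K] (lam : K)
    {X : Type u} [LinearOrder X] [WellFoundedLT X] :
    DPoly.Irr (DPoly.diffRelations lam X) = Set.range (DOmega.toWord X) ∧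
    Function.Injective (DOmega.toWord X) ∧
    (∃ b : Module.Basis (DPoly.Irr (DPoly.diffRelations lam X)) K (DiffAlg lam X),
      ∀ w, b w = DiffAlg.word lam w.1) ∧
    (∃ b : Module.Basis (FreeSemigroup (DOmega X)) K (DiffAlg lam X),
      ∀ w, b w = DiffAlg.word lam (DOmega.toWord X w)) ∧
    IsFreeLambdaDiff.{w} lam (DiffAlg.opD lam) (fun x : X => DiffAlg.word lam (DWord.var x)) := by
  have hirr := DPoly.irr_diffRelations lam (X := X)
  refine ⟨hirr, DOmega.toWord_injective, ?_, ⟨DiffAlg.omegaBasis lam, DiffAlg.omegaBasis_apply lam⟩,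
    DiffAlg.isFreeLambdaDiff lam⟩
  -- The basis indexed by `Irr(S)` is the one indexed by words on `D^ω(X)`, transported along the
  -- bijection of these words with their image.
  rw [hirr]
  refine ⟨(DiffAlg.omegaBasis lam).reindex
    (Equiv.ofInjective _ DOmega.toWord_injective), fun w => ?_⟩
  obtain ⟨_, w, rfl⟩ := w
  rw [Module.Basis.reindex_apply, DiffAlg.omegaBasis_apply]
  exact congrArg _ (Equiv.apply_ofInjective_symm DOmega.toWord_injective ⟨_, w, rfl⟩)
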